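/- Let $\Omega\subset\mathbb{R}^n$ be a bounded convex set with diameter $D_\Omega=\sup_{x,y\in\Omega}|x-y|$, where $|\cdot|$ is the Euclidean norm. Let $g:\mathbb{R}^n\to\mathbb{R}^n$ be injective on $\Omega$ and suppose that there is $L_{\Omega'}>0$ with $$|g(x)-g(y)|\le L_{\Omega'}\,|x-y|\qquad\text{for all } x,y\in\Omega .$$ Suppose also that $g$ is measure-preserving on $\Omega$, in the sense that $g$ is differentiable at every $x\in\Omega$ with Jacobian determinant $\det(D_xg)=1$. Put $\Omega'=g(\Omega)$, which need not be convex. Then for every partition $(\Omega_1',\Omega_2',\Omega_3')$ of $\Omega'$ into three pairwise disjoint Lebesgue measurable sets, $$\mathrm{vol}(\Omega_3')\;\ge\;\frac{d(\Omega_1',\Omega_2')}{4\,D_\Omega\,L_{\Omega'}}\,\min\{\mathrm{vol}(\Omega_1'),\mathrm{vol}(\Omega_2')\},$$ where $\mathrm{vol}$ is $n$-dimensional Lebesgue measure and $d(A,B)=\inf_{x\in A,\,y\in B}|x-y|$ (the right-hand side is read as $0$ if $\Omega_1'$ or $\Omega_2'$ is empty or $D_\Omega=0$). -/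

import Mathlib

open MeasureTheory Set

/-- The distance between two sets, the infimum of `|x - y|` over `x ∈ A`, `y ∈ B`. -/
noncomputable def setDist {n : ℕ} (A B : Set (EuclideanSpace ℝ (Fin n))) : ℝ :=
  sInf (image2 (fun x y => dist x y) A B)

/-- `(A₁, A₂, A₃)` is a partition of `S` into three pairwise disjoint Lebesgue measurable sets
(some of them possibly empty). -/
structure IsPartition₃ {n : ℕ} (S A₁ A₂ A₃ : Set (EuclideanSpace ℝ (Fin n))) : Prop where
  union_eq : A₁ ∪ A₂ ∪ A₃ = S
  disjoint₁₂ : Disjoint A₁ A₂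
  disjoint₁₃ : Disjoint A₁ A₃
  disjoint₂₃ : Disjoint A₂ A₃
  measurable₁ : NullMeasurableSet A₁ volume
  measurable₂ : NullMeasurableSet A₂ volume
  measurable₃ : NullMeasurableSet A₃ volume

/-- `g` is measure-preserving on `Ω`: at every point of `Ω` the map `g` is differentiable with
Jacobian determinant equal to `1`. -/
def HasUnitJacobianOn {n : ℕ} (g : EuclideanSpace ℝ (Fin n) → EuclideanSpace ℝ (Fin n))
    (Ω : Set (EuclideanSpace ℝ (Fin n))) : Prop :=
  ∀ x ∈ Ω, DifferentiableAt ℝ g x ∧ (fderiv ℝ g x).det = 1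

/-- `Ω'` is the image of `Ω` under an embedding `g` that is `L`-Lipschitz and measure-preserving
on `Ω`. -/
structure IsLipschitzMeasurePreservingEmbedding {n : ℕ}
    (g : EuclideanSpace ℝ (Fin n) → EuclideanSpace ℝ (Fin n))
    (Ω Ω' : Set (EuclideanSpace ℝ (Fin n))) (L : ℝ) : Prop where
  image_eq : g '' Ω = Ω'
  injOn : InjOn g Ω
  pos : 0 < L
  lipschitz : ∀ x ∈ Ω, ∀ y ∈ Ω, dist (g x) (g y) ≤ L * dist x y
  unit_jacobian : HasUnitJacobianOn g Ω

open ProbabilityTheory Filter Topology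
open scoped ENNReal

/-! A segment from a point of `S₁` to a point of `S₂` inside a convex body of diameter at most `D`
spends at least a fraction `δ / D` of its parameter interval outside both sets, where `δ` bounds
their distance from below. `SegmentIntegralIneq` turns this bound on segments into a bound on
volumes. On the line it is proved by monotone transport: quantile functions `X`, `Y` of the two
densities are interpolated by `(1 - t) X + t Y`, whose derivative is bounded below by weighted
AM-GM. Fubini then gives all dimensions. With indicators as densities this yields
`Convex.isoperimetric`, with constant `1 / D`.

The image under `g` is treated by pulling the partition back to the interior of `Ω`: volumes are
preserved, distances shrink by at most the factor `L`, and the boundary of `Ω` has null image. The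
resulting constant `1 / (D L)` is four times the one required. -/

/-! ### Quantile functions on the line -/

theorem continuous_cdf (μ : Measure ℝ) [IsProbabilityMeasure μ] [NullSingletonClass μ] :
    Continuous (cdf μ) := by
  rw [continuous_iff_continuousAt]
  intro x
  have h := (cdf μ).measure_singleton x
  rw [measure_cdf, measure_singleton, eq_comm, ENNReal.ofReal_eq_zero] at h
  rw [(monotone_cdf μ).continuousAt_iff_leftLim_eq_rightLim, StieltjesFunction.rightLim_eq]
  exact le_antisymm ((monotone_cdf μ).leftLim_le le_rfl) (by linarith)

theorem exists_cdf_eq (μ : Measure ℝ) [IsProbabilityMeasure μ] [NullSingletonClass μ] :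
    ∃ X : ℝ → ℝ, ∀ s ∈ Ioo (0 : ℝ) 1, cdf μ (X s) = s := by
  have h : ∀ s : ℝ, ∃ x, s ∈ Ioo (0 : ℝ) 1 → cdf μ x = s := by
    intro s
    by_cases hs : s ∈ Ioo (0 : ℝ) 1
    · obtain ⟨x, hx⟩ := mem_range_of_exists_le_of_exists_ge (continuous_cdf μ) (c := s)
        ((((tendsto_cdf_atBot μ).eventually (gt_mem_nhds hs.1)).exists).imp fun _ h => h.le)
        ((((tendsto_cdf_atTop μ).eventually (lt_mem_nhds hs.2)).exists).imp fun _ h => h.le)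
      exact ⟨x, fun _ => hx⟩
    · exact ⟨0, fun h => absurd h hs⟩
  choose X hX using h
  exact ⟨X, hX⟩

theorem strictMonoOn_of_cdf_eq {μ : Measure ℝ} {X : ℝ → ℝ}
    (hX : ∀ s ∈ Ioo (0 : ℝ) 1, cdf μ (X s) = s) : StrictMonoOn X (Ioo 0 1) := by
  intro s hs t ht hst
  by_contra! h
  have := monotone_cdf μ h
  rw [hX s hs, hX t ht] at this
  linarith

/-- Within the unit interval, `{X ≤ x}` lies between `(0, F x)` and `[0, F x]`, where `F` is the
cdf, so the pushforward and `μ` agree on every half-line. -/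
theorem map_eq_of_cdf_eq {μ : Measure ℝ} [IsProbabilityMeasure μ] {X : ℝ → ℝ}
    (hX : ∀ s ∈ Ioo (0 : ℝ) 1, cdf μ (X s) = s) :
    (volume.restrict (Ioo (0 : ℝ) 1)).map X = μ := by
  have hm : AEMeasurable X (volume.restrict (Ioo (0 : ℝ) 1)) :=
    aemeasurable_restrict_of_monotoneOn measurableSet_Ioo (strictMonoOn_of_cdf_eq hX).monotoneOn
  have : IsFiniteMeasure ((volume.restrict (Ioo (0 : ℝ) 1)).map X) := by
    infer_instance
  refine Measure.ext_of_Iic _ _ fun x => ?_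
  rw [Measure.map_apply_of_aemeasurable hm measurableSet_Iic, ← ofReal_cdf,
    Measure.restrict_apply₀' measurableSet_Ioo.nullMeasurableSet]
  apply le_antisymm
  · calc volume (X ⁻¹' Iic x ∩ Ioo 0 1) ≤ volume (Icc 0 (cdf μ x)) := by
          refine measure_mono fun s hs => ⟨hs.2.1.le, ?_⟩
          have := monotone_cdf μ (show X s ≤ x from hs.1)
          rwa [hX s hs.2] at this
      _ = _ := by simp
  · calc ENNReal.ofReal (cdf μ x) = volume (Ioo 0 (cdf μ x)) := by simp
      _ ≤ _ := by
          refine measure_mono fun s hs => ?_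
          have h1 : s ∈ Ioo (0 : ℝ) 1 := ⟨hs.1, hs.2.trans_le (cdf_le_one μ x)⟩
          refine ⟨?_, h1⟩
          by_contra h
          have := monotone_cdf μ (le_of_lt (not_le.1 h))
          rw [hX s h1] at this
          linarith [hs.2]

/-- A density on the line is parametrized over a subset of full measure of the unit interval by a
quantile function `X`, which satisfies `f (X s) * X' s = ∫ f`. -/
theorem exists_quantile {f : ℝ → ℝ≥0∞} (hf : Measurable f) (h0 : ∫⁻ x, f x ≠ 0)
    (htop : ∫⁻ x, f x ≠ ∞) :
    ∃ (X X' : ℝ → ℝ) (S : Set ℝ), S ⊆ Ioo 0 1 ∧ MeasurableSet S ∧ volume S = 1 ∧ Measurable X ∧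
      StrictMonoOn X S ∧ ∀ s ∈ S, HasDerivWithinAt X (X' s) S s ∧ 0 < X' s ∧ f (X s) ≠ 0 ∧
        f (X s) ≠ ∞ ∧ f (X s) * ENNReal.ofReal (X' s) = ∫⁻ x, f x := by
  set a := ∫⁻ x, f x with ha
  let p : ℝ → ℝ≥0∞ := fun x => f x / a
  have hp : Measurable p := hf.div_const a
  let μ : Measure ℝ := volume.withDensity p
  have hμ : μ ≪ volume := withDensity_absolutelyContinuous _ _
  have : IsProbabilityMeasure μ := ⟨by
    simp only [μ, p, withDensity_apply _ MeasurableSet.univ, Measure.restrict_univ]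
    simp only [div_eq_mul_inv]
    rw [lintegral_mul_const _ hf, ← ha, ENNReal.mul_inv_cancel h0 htop]⟩
  obtain ⟨X, hX⟩ := exists_cdf_eq μ
  have hmono := strictMonoOn_of_cdf_eq hX
  have hm : AEMeasurable X (volume.restrict (Ioo (0 : ℝ) 1)) :=
    aemeasurable_restrict_of_monotoneOn measurableSet_Ioo hmono.monotoneOn
  -- Lebesgue differentiation: the cdf has the density as derivative almost everywhere.
  have hder : ∀ᵐ x ∂μ, HasDerivAt (cdf μ) (p x).toReal x ∧ p x ≠ 0 ∧ p x ≠ ∞ := by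
    have h1 : ∀ᵐ x ∂μ, HasDerivAt (cdf μ) (p x).toReal x := by
      apply hμ.ae_le
      have h2 := (cdf μ).ae_hasDerivAt
      rw [measure_cdf] at h2
      filter_upwards [h2, Measure.rnDeriv_withDensity volume hp] with x hx hx2
      rwa [hx2] at hx
    have h2 : ∀ᵐ x ∂μ, p x ≠ 0 := by
      rw [ae_withDensity_iff hp]
      exact ae_of_all _ fun x hx => hx
    have h3 : ∀ᵐ x ∂μ, p x ≠ ∞ := by
      apply hμ.ae_le
      have : ∀ᵐ x, f x < ∞ := ae_lt_top hf htop
      filter_upwards [this] with x hx using ENNReal.div_ne_top hx.ne h0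
    filter_upwards [h1, h2, h3] with x a b c using ⟨a, b, c⟩
  have hgood : ∀ᵐ s ∂(volume.restrict (Ioo (0 : ℝ) 1)),
      HasDerivAt (cdf μ) (p (X s)).toReal (X s) ∧ p (X s) ≠ 0 ∧ p (X s) ≠ ∞ := by
    rw [← map_eq_of_cdf_eq hX] at hder
    have := ae_of_ae_map hm hder
    rwa [map_eq_of_cdf_eq hX] at this
  have hdiff : ∀ᵐ s ∂(volume.restrict (Ioo (0 : ℝ) 1)), DifferentiableWithinAt ℝ X (Ioo 0 1) s :=
    hmono.monotoneOn.ae_differentiableWithinAt measurableSet_Ioo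
  have hmem : ∀ᵐ s ∂(volume.restrict (Ioo (0 : ℝ) 1)), s ∈ Ioo (0 : ℝ) 1 :=
    ae_restrict_mem measurableSet_Ioo
  have hall := hmem.and (hgood.and (hdiff.and hm.ae_eq_mk))
  -- Discarding a measurable null set makes every property hold pointwise and lets `X` be replaced
  -- by a measurable version.
  obtain ⟨T, hTsub, hTm, hT0⟩ :=
    exists_measurable_superset_of_null (ae_iff.1 hall)
  have hS : ∀ s ∈ Ioo (0 : ℝ) 1 \ T, (HasDerivAt (cdf μ) (p (X s)).toReal (X s) ∧
      p (X s) ≠ 0 ∧ p (X s) ≠ ∞) ∧ DifferentiableWithinAt ℝ X (Ioo 0 1) s ∧ X s = hm.mk X s := by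
    intro s hs
    by_contra h
    exact hs.2 (hTsub fun h' => h h'.2)
  refine ⟨hm.mk X, deriv X, Ioo 0 1 \ T, sdiff_subset, measurableSet_Ioo.diff hTm, ?_,
    hm.measurable_mk, ?_, ?_⟩
  · have : volume (T ∩ Ioo 0 1) = 0 := by
      rwa [Measure.restrict_apply hTm] at hT0
    rw [← sdiff_inter_self_eq_sdiff, measure_sdiff_null this]
    simp
  · intro s hs t ht hst
    rw [← (hS s hs).2.2, ← (hS t ht).2.2]
    exact hmono hs.1 ht.1 hst
  · intro s hs
    obtain ⟨⟨h1, h2, h3⟩, h4, h5⟩ := hS s hs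
    have hnhds : Ioo (0 : ℝ) 1 ∈ 𝓝 s := Ioo_mem_nhds hs.1.1 hs.1.2
    have hXd : HasDerivAt X (deriv X s) s := (h4.differentiableAt hnhds).hasDerivAt
    -- Differentiate `cdf μ (X s) = s`.
    have hchain : (p (X s)).toReal * deriv X s = 1 := by
      refine (h1.comp s hXd).unique ((hasDerivAt_id s).congr_of_eventuallyEq ?_)
      filter_upwards [hnhds] with r hr using hX r hr
    have hppos : 0 < (p (X s)).toReal := ENNReal.toReal_pos h2 h3
    have hpos : 0 < deriv X s := by
      by_contra! h
      nlinarith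
    have hf0 : f (X s) ≠ 0 := fun h => h2 (by simp [p, h])
    have hft : f (X s) ≠ ∞ := fun h => h3 (by simp [p, h, ENNReal.top_div_of_ne_top htop])
    refine ⟨?_, hpos, h5 ▸ hf0, h5 ▸ hft, ?_⟩
    · exact hXd.hasDerivWithinAt.congr (fun r hr => (hS r hr).2.2.symm) h5.symm
    · rw [← h5]
      have h6 : p (X s) * ENNReal.ofReal (deriv X s) = 1 := by
        rw [← ENNReal.ofReal_toReal h3, ← ENNReal.ofReal_mul hppos.le, hchain, ENNReal.ofReal_one]
      have h7 : f (X s) = p (X s) * a := (ENNReal.div_mul_cancel h0 htop).symm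
      rw [h7, mul_right_comm, h6, one_mul]

/-! ### The integrated inequality along segments -/

/-- Weighted AM-GM for `u` and `v`. In the application these are the derivatives of the two quantile
functions, and the arithmetic mean is that of their interpolation. -/
theorem rpow_mul_rpow_le_ofReal_mul {f g a b : ℝ≥0∞} {u v t : ℝ} (hu : 0 < u) (hv : 0 < v)
    (ht : t ∈ Ioo (0 : ℝ) 1) (hf : f * ENNReal.ofReal u = a) (hg : g * ENNReal.ofReal v = b) :
    a ^ (1 - t) * b ^ t ≤ ENNReal.ofReal ((1 - t) * u + t * v) * (f ^ (1 - t) * g ^ t) := by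
  have h1 : 0 ≤ 1 - t := by linarith [ht.2]
  rw [← hf, ← hg, ENNReal.mul_rpow_of_nonneg _ _ h1, ENNReal.mul_rpow_of_nonneg _ _ ht.1.le,
    mul_mul_mul_comm, mul_comm]
  gcongr
  rw [ENNReal.ofReal_rpow_of_pos hu, ENNReal.ofReal_rpow_of_pos hv,
    ← ENNReal.ofReal_mul (Real.rpow_nonneg hu.le _)]
  exact ENNReal.ofReal_le_ofReal
    (Real.geom_mean_le_arith_mean2_weighted h1 ht.1.le hu.le hv.le (by ring))

theorem rpow_mul_rpow_ne_zero {a b : ℝ≥0∞} {t : ℝ} (ha : a ≠ 0) (ha' : a ≠ ∞) (hb : b ≠ 0)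
    (hb' : b ≠ ∞) : a ^ (1 - t) * b ^ t ≠ 0 := by
  simp [ENNReal.rpow_eq_zero_iff, ha, ha', hb, hb']

theorem rpow_mul_rpow_ne_top {a b : ℝ≥0∞} {t : ℝ} (ha : a ≠ 0) (ha' : a ≠ ∞) (hb : b ≠ 0)
    (hb' : b ≠ ∞) : a ^ (1 - t) * b ^ t ≠ ∞ :=
  ENNReal.mul_ne_top (ENNReal.rpow_ne_top_of_ne_zero ha ha') (ENNReal.rpow_ne_top_of_ne_zero hb hb')

/-- An integrated inequality of Prékopa–Leindler type: a lower bound for the average of `φ` along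
all segments from the support of `f` to the support of `g` passes to the integrals. -/
def SegmentIntegralIneq {E : Type*} [AddCommGroup E] [Module ℝ E] [MeasurableSpace E]
    (μ : Measure E) : Prop :=
  ∀ ⦃f g : E → ℝ≥0∞⦄ ⦃φ : ℝ × E → ℝ≥0∞⦄ ⦃c : ℝ≥0∞⦄, Measurable f → Measurable g → Measurable φ →
    ∫⁻ x, f x ∂μ ≠ 0 → ∫⁻ x, f x ∂μ ≠ ∞ → ∫⁻ x, g x ∂μ ≠ 0 → ∫⁻ x, g x ∂μ ≠ ∞ →
    (∀ x y, f x ≠ 0 → f x ≠ ∞ → g y ≠ 0 → g y ≠ ∞ →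
      c ≤ ∫⁻ t in Ioo (0 : ℝ) 1, φ (t, (1 - t) • x + t • y) / (f x ^ (1 - t) * g y ^ t)) →
    c ≤ ∫⁻ t in Ioo (0 : ℝ) 1,
      (∫⁻ z, φ (t, z) ∂μ) / ((∫⁻ x, f x ∂μ) ^ (1 - t) * (∫⁻ x, g x ∂μ) ^ t)

/-- The hypothesis is used only on the pairs `(X s, Y s)` matched by monotone transport. It is
averaged over `s`, the integrals are exchanged, and for fixed `t` the substitution `z = (1 - t) X s
+ t Y s` bounds the integral over `s`. -/
theorem segmentIntegralIneq_real : SegmentIntegralIneq (volume : Measure ℝ) := by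
  intro f g φ c hf hg hφ hf0 hft hg0 hgt h
  obtain ⟨X, X', S, hS01, hSm, hS1, hXm, hXmono, hX⟩ := exists_quantile hf hf0 hft
  obtain ⟨Y, Y', T, hT01, hTm, hT1, hYm, hYmono, hY⟩ := exists_quantile hg hg0 hgt
  set a := ∫⁻ x, f x
  set b := ∫⁻ x, g x
  have hmeas : Measurable fun p : ℝ × ℝ =>
      φ (p.1, (1 - p.1) • X p.2 + p.1 • Y p.2) / (f (X p.2) ^ (1 - p.1) * g (Y p.2) ^ p.1) := by
    fun_prop
  have hUm : MeasurableSet (S ∩ T) := hSm.inter hTm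
  have hU1 : volume (S ∩ T) = 1 := by
    have hT0 : volume (Ioo (0 : ℝ) 1 \ T) = 0 := by
      rw [measure_sdiff hT01 hTm.nullMeasurableSet (by simp [hT1]), hT1]
      simp
    have : S \ (Ioo (0 : ℝ) 1 \ T) = S ∩ T := by
      ext s
      have := @hS01 s
      simp only [Set.mem_sdiff, mem_inter_iff]
      tauto
    rw [← this, measure_sdiff_null hT0, hS1]
  have key : ∀ t ∈ Ioo (0 : ℝ) 1,
      ∫⁻ s in S ∩ T, φ (t, (1 - t) • X s + t • Y s) / (f (X s) ^ (1 - t) * g (Y s) ^ t) ≤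
        (∫⁻ z, φ (t, z)) / (a ^ (1 - t) * b ^ t) := by
    intro t ht
    have h1t : 0 < 1 - t := by linarith [ht.2]
    let Z : ℝ → ℝ := fun s => (1 - t) * X s + t * Y s
    let Z' : ℝ → ℝ := fun s => (1 - t) * X' s + t * Y' s
    have hZ : ∀ s ∈ S ∩ T, HasDerivWithinAt Z (Z' s) (S ∩ T) s := fun s hs =>
      (((hX s hs.1).1.mono inter_subset_left).const_mul (1 - t)).add
        (((hY s hs.2).1.mono inter_subset_right).const_mul t)
    have hZmono : StrictMonoOn Z (S ∩ T) := by
      intro s hs r hr hsr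
      have h1 := mul_lt_mul_of_pos_left (hXmono hs.1 hr.1 hsr) h1t
      have h2 := mul_lt_mul_of_pos_left (hYmono hs.2 hr.2 hsr) ht.1
      exact add_lt_add h1 h2
    calc _ ≤ ∫⁻ s in S ∩ T, ENNReal.ofReal |Z' s| * (φ (t, Z s) / (a ^ (1 - t) * b ^ t)) := by
          refine setLIntegral_mono' hUm fun s hs => ?_
          obtain ⟨-, hX'0, hfX0, hfXt, hfX⟩ := hX s hs.1
          obtain ⟨-, hY'0, hgY0, hgYt, hgY⟩ := hY s hs.2
          have hw := rpow_mul_rpow_le_ofReal_mul hX'0 hY'0 ht hfX hgY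
          have hZ' : |Z' s| = (1 - t) * X' s + t * Y' s :=
            abs_of_pos (add_pos (mul_pos h1t hX'0) (mul_pos ht.1 hY'0))
          rw [hZ']
          have hA0 := rpow_mul_rpow_ne_zero (t := t) hfX0 hfXt hgY0 hgYt
          have hAt := rpow_mul_rpow_ne_top (t := t) hfX0 hfXt hgY0 hgYt
          have hB0 := rpow_mul_rpow_ne_zero (t := t) hf0 hft hg0 hgt
          have hBt := rpow_mul_rpow_ne_top (t := t) hf0 hft hg0 hgt
          rw [ENNReal.div_le_iff hA0 hAt]
          calc φ (t, (1 - t) • X s + t • Y s)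
              = φ (t, Z s) / (a ^ (1 - t) * b ^ t) * (a ^ (1 - t) * b ^ t) := by
                rw [ENNReal.div_mul_cancel hB0 hBt]; rfl
            _ ≤ φ (t, Z s) / (a ^ (1 - t) * b ^ t) * _ := mul_le_mul_right hw _
            _ = _ := by ring
      _ = ∫⁻ z in Z '' (S ∩ T), φ (t, z) / (a ^ (1 - t) * b ^ t) :=
          (lintegral_image_eq_lintegral_abs_deriv_mul hUm hZ hZmono.injOn
            fun z => φ (t, z) / (a ^ (1 - t) * b ^ t)).symm
      _ ≤ ∫⁻ z, φ (t, z) / (a ^ (1 - t) * b ^ t) := setLIntegral_le_lintegral _ _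
      _ = _ := by
          simp only [div_eq_mul_inv]
          exact lintegral_mul_const _ (by fun_prop)
  calc c = ∫⁻ s in S ∩ T, c := by rw [setLIntegral_const, hU1, mul_one]
    _ ≤ ∫⁻ s in S ∩ T, ∫⁻ t in Ioo (0 : ℝ) 1,
          φ (t, (1 - t) • X s + t • Y s) / (f (X s) ^ (1 - t) * g (Y s) ^ t) := by
        refine setLIntegral_mono' hUm fun s hs => ?_
        obtain ⟨-, -, h1, h2, -⟩ := hX s hs.1
        obtain ⟨-, -, h3, h4, -⟩ := hY s hs.2
        exact h _ _ h1 h2 h3 h4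
    _ = ∫⁻ t in Ioo (0 : ℝ) 1, ∫⁻ s in S ∩ T,
          φ (t, (1 - t) • X s + t • Y s) / (f (X s) ^ (1 - t) * g (Y s) ^ t) :=
        lintegral_lintegral_swap (hmeas.comp measurable_swap).aemeasurable
    _ ≤ _ := setLIntegral_mono' measurableSet_Ioo key

/-- For fixed first coordinates, the inequality for `ν` on the slices is exactly the hypothesis
needed by `μ` for the marginals. The slice of `φ` moves with `t`, which is why `φ` must be allowed
to depend on `t`. -/
theorem SegmentIntegralIneq.prod {E F : Type*} [AddCommGroup E] [Module ℝ E] [MeasurableSpace E]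
    [MeasurableAdd₂ E] [MeasurableSMul₂ ℝ E] [AddCommGroup F] [Module ℝ F] [MeasurableSpace F]
    {μ : Measure E} {ν : Measure F} [SFinite μ] [SFinite ν] (hμ : SegmentIntegralIneq μ)
    (hν : SegmentIntegralIneq ν) :
    SegmentIntegralIneq (μ.prod ν) := by
  intro f g φ c hf hg hφ hf0 hft hg0 hgt h
  rw [lintegral_prod _ hf.aemeasurable] at hf0 hft ⊢
  rw [lintegral_prod _ hg.aemeasurable] at hg0 hgt ⊢
  have hφ' : ∀ t, ∫⁻ z, φ (t, z) ∂(μ.prod ν) = ∫⁻ x, ∫⁻ y, φ (t, (x, y)) ∂ν ∂μ := fun t =>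
    lintegral_prod _ (hφ.comp measurable_prodMk_left).aemeasurable
  simp only [hφ']
  refine hμ (φ := fun p => ∫⁻ y, φ (p.1, (p.2, y)) ∂ν) hf.lintegral_prod_right'
    hg.lintegral_prod_right' ?_ hf0 hft hg0 hgt ?_
  · exact Measurable.lintegral_prod_right' (f := fun q : (ℝ × E) × F => φ (q.1.1, (q.1.2, q.2)))
      (by fun_prop)
  · intro x₁ y₁ h1 h2 h3 h4
    refine hν (f := fun x => f (x₁, x)) (g := fun y => g (y₁, y))
      (φ := fun p => φ (p.1, ((1 - p.1) • x₁ + p.1 • y₁, p.2))) (by fun_prop) (by fun_prop)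
      (by fun_prop) h1 h2 h3 h4 fun x y => h (x₁, x) (y₁, y)

theorem SegmentIntegralIneq.of_measurePreserving {E F : Type*} [AddCommGroup E] [Module ℝ E]
    [MeasurableSpace E] [AddCommGroup F] [Module ℝ F] [MeasurableSpace F] {μ : Measure E}
    {ν : Measure F} (hμ : SegmentIntegralIneq μ) (e : E →ₗ[ℝ] F) (he : MeasurePreserving e μ ν) :
    SegmentIntegralIneq ν := by
  intro f g φ c hf hg hφ hf0 hft hg0 hgt h
  have hφ' : ∀ t, ∫⁻ z, φ (t, z) ∂ν = ∫⁻ z, φ (t, e z) ∂μ := fun t =>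
    (he.lintegral_comp (f := fun z => φ (t, z)) (by fun_prop)).symm
  have hem : Measurable e := he.measurable
  simp only [hφ']
  rw [← he.lintegral_comp hf] at hf0 hft ⊢
  rw [← he.lintegral_comp hg] at hg0 hgt ⊢
  refine hμ (φ := fun p => φ (p.1, e p.2)) (hf.comp hem) (hg.comp hem) (by fun_prop)
    hf0 hft hg0 hgt fun x y h1 h2 h3 h4 => ?_
  simpa using h (e x) (e y) h1 h2 h3 h4

theorem segmentIntegralIneq_pi (n : ℕ) : SegmentIntegralIneq (volume : Measure (Fin n → ℝ)) := by
  induction n with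
  | zero =>
    intro f g φ c hf hg hφ hf0 hft hg0 hgt h
    -- On a one-point space of mass one, integrals are values, and the conclusion is the hypothesis.
    have hv : (volume : Measure (Fin 0 → ℝ)) univ = 1 := by simp [volume_pi]
    simp only [lintegral_unique, hv, mul_one] at hf0 hft hg0 hgt ⊢
    refine (h _ _ hf0 hft hg0 hgt).trans_eq (lintegral_congr fun t => ?_)
    congr!
  | succ n ih =>
    let e : (ℝ × (Fin n → ℝ)) →ₗ[ℝ] (Fin (n + 1) → ℝ) :=
      { toFun := fun p => Fin.cons p.1 p.2
        map_add' := fun p q => by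
          ext i; refine Fin.cases ?_ (fun j => ?_) i <;> simp
        map_smul' := fun r p => by
          ext i; refine Fin.cases ?_ (fun j => ?_) i <;> simp }
    refine (segmentIntegralIneq_real.prod ih).of_measurePreserving e ?_
    have := (volume_preserving_piFinSuccAbove (fun _ : Fin (n + 1) => ℝ) 0).symm
    have he : ⇑e = (MeasurableEquiv.piFinSuccAbove (fun _ : Fin (n + 1) => ℝ) 0).symm := by
      funext p
      simp [e, MeasurableEquiv.piFinSuccAbove, Fin.insertNthEquiv]
    rw [he]
    exact this

theorem segmentIntegralIneq_euclideanSpace (n : ℕ) :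
    SegmentIntegralIneq (volume : Measure (EuclideanSpace ℝ (Fin n))) :=
  (segmentIntegralIneq_pi n).of_measurePreserving
    (WithLp.linearEquiv 2 ℝ (Fin n → ℝ)).symm.toLinearMap (PiLp.volume_preserving_toLp (Fin n))

/-! ### Isoperimetry in convex sets -/

/-- With `b` the infimum of `T₂` in the unit interval and `a` the supremum of `T₁` in `[0, b]`, the
gap `(a, b)` misses both sets and has length at least `δ`. -/
theorem le_volume_Ioo_diff_union {T₁ T₂ : Set ℝ} {δ : ℝ} (h0 : (0 : ℝ) ∈ T₁) (h1 : (1 : ℝ) ∈ T₂)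
    (h : ∀ s ∈ T₁, ∀ t ∈ T₂, δ ≤ |s - t|) :
    ENNReal.ofReal δ ≤ volume (Ioo (0 : ℝ) 1 \ (T₁ ∪ T₂)) := by
  set b := sInf (T₂ ∩ Icc 0 1)
  have hb_ne : (T₂ ∩ Icc (0 : ℝ) 1).Nonempty := ⟨1, h1, by simp⟩
  have hb_bdd : BddBelow (T₂ ∩ Icc (0 : ℝ) 1) := bddBelow_Icc.mono inter_subset_right
  have hb0 : 0 ≤ b := le_csInf hb_ne fun s hs => hs.2.1
  have hb1 : b ≤ 1 := csInf_le hb_bdd ⟨h1, by simp⟩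
  set a := sSup (T₁ ∩ Icc 0 b)
  have ha_ne : (T₁ ∩ Icc (0 : ℝ) b).Nonempty := ⟨0, h0, by simpa using hb0⟩
  have ha_bdd : BddAbove (T₁ ∩ Icc (0 : ℝ) b) := bddAbove_Icc.mono inter_subset_right
  have ha0 : 0 ≤ a := le_csSup ha_bdd ⟨h0, by simpa using hb0⟩
  have hab : a ≤ b - δ := by
    refine csSup_le ha_ne fun r hr => ?_
    have : r + δ ≤ b := by
      refine le_csInf hb_ne fun s hs => ?_
      have h2 : r ≤ s := hr.2.2.trans (csInf_le hb_bdd hs)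
      have h3 := h r hr.1 s hs.1
      rw [abs_of_nonpos (by linarith)] at h3
      linarith
    linarith
  calc ENNReal.ofReal δ ≤ ENNReal.ofReal (b - a) := ENNReal.ofReal_le_ofReal (by linarith)
    _ = volume (Ioo a b) := Real.volume_Ioo.symm
    _ ≤ _ := by
      refine measure_mono fun t ht => ⟨⟨ha0.trans_lt ht.1, ht.2.trans_le hb1⟩, ?_⟩
      have ht0 : 0 ≤ t := ha0.trans ht.1.le
      rintro (h2 | h2)
      · exact absurd (le_csSup ha_bdd ⟨h2, ht0, ht.2.le⟩) (not_le.2 ht.1)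
      · exact absurd (csInf_le hb_bdd ⟨h2, ht0, ht.2.le.trans hb1⟩) (not_le.2 ht.2)

/-- Isoperimetric inequality for convex sets. -/
theorem Convex.isoperimetric {n : ℕ} {K S₁ S₂ : Set (EuclideanSpace ℝ (Fin n))} {δ D : ℝ}
    (hK : Convex ℝ K) (hKm : MeasurableSet K) (hKv : volume K ≠ ∞) (hD : 0 < D)
    (hKD : ∀ x ∈ K, ∀ y ∈ K, dist x y ≤ D) (h₁ : S₁ ⊆ K) (h₂ : S₂ ⊆ K) (hm₁ : MeasurableSet S₁)
    (hm₂ : MeasurableSet S₂) (hδ : ∀ x ∈ S₁, ∀ y ∈ S₂, δ ≤ dist x y) :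
    ENNReal.ofReal (δ / D) * min (volume S₁) (volume S₂) ≤ volume (K \ (S₁ ∪ S₂)) := by
  have hf₁ : volume S₁ ≠ ∞ := measure_ne_top_of_subset h₁ hKv
  have hf₂ : volume S₂ ≠ ∞ := measure_ne_top_of_subset h₂ hKv
  rcases eq_or_ne (volume S₁) 0 with hz₁ | hz₁
  · simp [hz₁]
  rcases eq_or_ne (volume S₂) 0 with hz₂ | hz₂
  · simp [hz₂]
  set S₃ := K \ (S₁ ∪ S₂) with hS₃
  have hm₃ : MeasurableSet S₃ := hKm.diff (hm₁.union hm₂)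
  have key := segmentIntegralIneq_euclideanSpace n (f := S₁.indicator 1) (g := S₂.indicator 1)
    (φ := fun p => S₃.indicator 1 p.2) (c := ENNReal.ofReal (δ / D))
    (measurable_one.indicator hm₁) (measurable_one.indicator hm₂)
    ((measurable_one.indicator hm₃).comp measurable_snd)
  simp only [lintegral_indicator_one hm₁, lintegral_indicator_one hm₂,
    lintegral_indicator_one hm₃] at key
  have key' := key hz₁ hf₁ hz₂ hf₂ ?_
  -- Replacing both volumes by their minimum `m` makes the geometric mean equal to `m` for every
  -- `t`.
  · set m := min (volume S₁) (volume S₂) with hm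
    have hm0 : m ≠ 0 := (lt_min hz₁.bot_lt hz₂.bot_lt).ne'
    have hmt : m ≠ ∞ := ((min_le_left _ _).trans_lt hf₁.lt_top).ne
    rw [← ENNReal.le_div_iff_mul_le (Or.inl hm0) (Or.inl hmt)]
    calc _ ≤ _ := key'
      _ ≤ ∫⁻ t in Ioo (0 : ℝ) 1, volume S₃ / m := by
        refine setLIntegral_mono' measurableSet_Ioo fun t ht => ?_
        gcongr
        calc m = m ^ (1 - t) * m ^ t := by
              rw [← ENNReal.rpow_add _ _ hm0 hmt]; simp
          _ ≤ _ := mul_le_mul'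
              (ENNReal.rpow_le_rpow (min_le_left _ _) (by linarith [ht.2]))
              (ENNReal.rpow_le_rpow (min_le_right _ _) ht.1.le)
      _ = _ := by simp
  · intro x y hx _ hy _
    have hx : x ∈ S₁ := mem_of_indicator_ne_zero hx
    have hy : y ∈ S₂ := mem_of_indicator_ne_zero hy
    let z : ℝ → EuclideanSpace ℝ (Fin n) := fun t => (1 - t) • x + t • y
    have hz : Measurable z := by fun_prop
    -- The segment has speed at most `D`, so the parameter sets over `S₁` and `S₂` are `δ / D`
    -- apart.
    have hdist : ∀ s t, dist (z s) (z t) ≤ |s - t| * D := by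
      intro s t
      have : z s - z t = (s - t) • (y - x) := by simp only [z]; module
      rw [dist_eq_norm, this, norm_smul, Real.norm_eq_abs, ← dist_eq_norm]
      exact mul_le_mul_of_nonneg_left (hKD y (h₂ hy) x (h₁ hx)) (abs_nonneg _)
    have hle := le_volume_Ioo_diff_union (T₁ := z ⁻¹' S₁) (T₂ := z ⁻¹' S₂) (δ := δ / D)
      (by simpa [z] using hx) (by simpa [z] using hy) fun s hs t ht => by
        rw [div_le_iff₀ hD]
        exact (hδ _ hs _ ht).trans (hdist s t)
    refine hle.trans ?_
    simp only [indicator_of_mem hx, indicator_of_mem hy, Pi.one_apply, ENNReal.one_rpow, mul_one,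
      div_one]
    have : ∀ t, S₃.indicator (1 : EuclideanSpace ℝ (Fin n) → ℝ≥0∞) ((1 - t) • x + t • y) =
        (z ⁻¹' S₃).indicator 1 t := fun t => rfl
    simp only [this]
    rw [lintegral_indicator_one (hz hm₃), Measure.restrict_apply (hz hm₃)]
    refine measure_mono fun t ht => ⟨⟨?_, ht.2⟩, ht.1⟩
    exact hK (h₁ hx) (h₂ hy) (by linarith [ht.1.2]) ht.1.1.le (by ring)

/-! ### Transfer through the embedding -/

theorem HasUnitJacobianOn.volume_image {n : ℕ}
    {g : EuclideanSpace ℝ (Fin n) → EuclideanSpace ℝ (Fin n)} {Ω S : Set (EuclideanSpace ℝ (Fin n))}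
    (hg : HasUnitJacobianOn g Ω) (hinj : InjOn g Ω) (hS : S ⊆ Ω) (hm : MeasurableSet S) :
    volume (g '' S) = volume S := by
  rw [← lintegral_abs_det_fderiv_eq_addHaar_image volume hm
    (fun x hx => (hg x (hS hx)).1.hasFDerivAt.hasFDerivWithinAt) (hinj.mono hS),
    ← setLIntegral_one]
  refine setLIntegral_congr_fun hm fun x hx => ?_
  simp [(hg x (hS hx)).2]

theorem setDist_nonneg {n : ℕ} (A B : Set (EuclideanSpace ℝ (Fin n))) : 0 ≤ setDist A B :=
  Real.sInf_nonneg (by rintro _ ⟨x, _, y, _, rfl⟩; exact dist_nonneg)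

theorem setDist_le_dist {n : ℕ} {A B : Set (EuclideanSpace ℝ (Fin n))}
    {x y : EuclideanSpace ℝ (Fin n)} (hx : x ∈ A) (hy : y ∈ B) : setDist A B ≤ dist x y :=
  csInf_le ⟨0, by rintro _ ⟨x, _, y, _, rfl⟩; exact dist_nonneg⟩ ⟨x, hx, y, hy, rfl⟩

/-- Isoperimetric inequality for images of bounded convex sets under measure-preserving Lipschitz
embeddings. -/
theorem IsLipschitzMeasurePreservingEmbedding.isoperimetric {n : ℕ}
    {Ω Ω' : Set (EuclideanSpace ℝ (Fin n))}
    {g : EuclideanSpace ℝ (Fin n) → EuclideanSpace ℝ (Fin n)} {L : ℝ}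
    (hg : IsLipschitzMeasurePreservingEmbedding g Ω Ω' L) (hconv : Convex ℝ Ω)
    (hbdd : Bornology.IsBounded Ω) (hD : 0 < Metric.diam Ω)
    {A₁ A₂ A₃ : Set (EuclideanSpace ℝ (Fin n))} (hA : IsPartition₃ Ω' A₁ A₂ A₃) :
    volume A₃ ≠ ∞ ∧ ENNReal.ofReal (setDist A₁ A₂ / L / Metric.diam Ω) *
      min (volume A₁) (volume A₂) ≤ volume A₃ := by
  -- The interior is open, hence Borel, whereas a convex set need not be.
  set U := interior Ω with hU
  have hUΩ : U ⊆ Ω := interior_subset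
  have hvol : ∀ S ⊆ U, MeasurableSet S → volume (g '' S) = volume S := fun S hS hm =>
    hg.unit_jacobian.volume_image hg.injOn (hS.trans hUΩ) hm
  have hUtop : volume U ≠ ∞ := (hbdd.subset hUΩ).measure_lt_top.ne
  -- The frontier of a convex set is null, and differentiable maps send null sets to null sets.
  have hnull : volume (g '' (Ω \ U)) = 0 := by
    refine addHaar_image_eq_zero_of_differentiableOn_of_addHaar_eq_zero volume
      (fun x hx => (hg.unit_jacobian x hx.1).1.differentiableWithinAt) ?_
    refine measure_mono_null ?_ (hconv.addHaar_frontier volume)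
    exact sdiff_subset_sdiff_left subset_closure
  have hΩ' : Ω' ⊆ g '' U ∪ g '' (Ω \ U) := by
    rw [← image_union, union_sdiff_cancel hUΩ, hg.image_eq]
  have hAΩ : ∀ i, ![A₁, A₂, A₃] i ⊆ Ω' := by
    rw [← hA.union_eq]
    intro i
    fin_cases i
    · exact subset_union_left.trans subset_union_left
    · exact subset_union_right.trans subset_union_left
    · exact subset_union_right
  have hA₁ : A₁ ⊆ Ω' := hAΩ 0
  have hA₂ : A₂ ⊆ Ω' := hAΩ 1
  have hA₃ : A₃ ⊆ Ω' := hAΩ 2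
  have hfin : volume A₃ ≠ ∞ := by
    refine ne_top_of_le_ne_top hUtop ?_
    calc volume A₃ ≤ volume (g '' U ∪ g '' (Ω \ U)) := measure_mono (hA₃.trans hΩ')
      _ ≤ volume (g '' U) + volume (g '' (Ω \ U)) := measure_union_le _ _
      _ = volume U := by rw [hnull, add_zero, hvol U subset_rfl isOpen_interior.measurableSet]
  refine ⟨hfin, ?_⟩
  have hgU : ContinuousOn g U := fun x hx =>
    (hg.unit_jacobian x (hUΩ hx)).1.continuousAt.continuousWithinAt
  have hpre : ∀ C, MeasurableSet C → MeasurableSet (U ∩ g ⁻¹' C) := by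
    intro C hC
    classical
    -- `g` is controlled only on `Ω`, so its restriction to `U` is extended by zero to a measurable
    -- map.
    have h1 : Measurable (U.piecewise g 0) :=
      hgU.measurable_piecewise continuousOn_const isOpen_interior.measurableSet
    have h2 : U ∩ g ⁻¹' C = U ∩ U.piecewise g 0 ⁻¹' C := by
      ext x
      simp +contextual
    rw [h2]
    exact isOpen_interior.measurableSet.inter (h1 hC)
  have hpull : ∀ C ⊆ Ω', MeasurableSet C → volume (U ∩ g ⁻¹' C) = volume C := by
    intro C hC hCm
    rw [← hvol _ inter_subset_left (hpre C hCm), image_inter_preimage]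
    apply le_antisymm (measure_mono inter_subset_right)
    calc volume C ≤ volume (g '' U ∩ C ∪ g '' (Ω \ U)) := by
          refine measure_mono fun y hy => ?_
          rcases hΩ' (hC hy) with h | h
          · exact Or.inl ⟨h, hy⟩
          · exact Or.inr h
      _ ≤ _ := by
          refine (measure_union_le _ _).trans ?_
          rw [hnull, add_zero]
  -- The parts are only null measurable. Passing to Borel subsets of full measure keeps the lower
  -- bound on distances.
  obtain ⟨C₁, hC₁, hCm₁, hCe₁⟩ := hA.measurable₁.exists_measurable_subset_ae_eq
  obtain ⟨C₂, hC₂, hCm₂, hCe₂⟩ := hA.measurable₂.exists_measurable_subset_ae_eq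
  have hiso := (hconv.interior).isoperimetric (δ := setDist A₁ A₂ / L) (D := Metric.diam Ω)
    isOpen_interior.measurableSet hUtop hD
    (fun x hx y hy => Metric.dist_le_diam_of_mem hbdd (hUΩ hx) (hUΩ hy))
    inter_subset_left inter_subset_left (hpre C₁ hCm₁) (hpre C₂ hCm₂) fun x hx y hy => by
      rw [div_le_iff₀' hg.pos]
      exact (setDist_le_dist (hC₁ hx.2) (hC₂ hy.2)).trans
        (hg.lipschitz x (hUΩ hx.1) y (hUΩ hy.1))
  rw [hpull C₁ (hC₁.trans hA₁) hCm₁, hpull C₂ (hC₂.trans hA₂) hCm₂, measure_congr hCe₁,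
    measure_congr hCe₂] at hiso
  refine hiso.trans ?_
  rw [← hvol _ sdiff_subset
    (isOpen_interior.measurableSet.diff ((hpre C₁ hCm₁).union (hpre C₂ hCm₂)))]
  -- What the Borel subsets leave out of `A₁` and `A₂` is added to `A₃` at no cost in volume.
  calc _ ≤ volume (A₃ ∪ (A₁ \ C₁ ∪ A₂ \ C₂)) := by
        refine measure_mono ?_
        rintro _ ⟨x, ⟨hxU, hx⟩, rfl⟩
        have hgx : g x ∈ A₁ ∪ A₂ ∪ A₃ := by
          rw [hA.union_eq, ← hg.image_eq]
          exact mem_image_of_mem g (hUΩ hxU)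
        have hx₁ : g x ∉ C₁ := fun h => hx (Or.inl ⟨hxU, h⟩)
        have hx₂ : g x ∉ C₂ := fun h => hx (Or.inr ⟨hxU, h⟩)
        rcases hgx with (h | h) | h
        · exact Or.inr (Or.inl ⟨h, hx₁⟩)
        · exact Or.inr (Or.inr ⟨h, hx₂⟩)
        · exact Or.inl h
    _ ≤ volume A₃ + (volume (A₁ \ C₁) + volume (A₂ \ C₂)) :=
        (measure_union_le _ _).trans (by gcongr; exact measure_union_le _ _)
    _ = volume A₃ := by
        rw [ae_le_set.1 hCe₁.symm.le, ae_le_set.1 hCe₂.symm.le, add_zero, add_zero]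

theorem mainTheorem2 {n : ℕ} (Ω Ω' : Set (EuclideanSpace ℝ (Fin n)))
    (g : EuclideanSpace ℝ (Fin n) → EuclideanSpace ℝ (Fin n)) (L : ℝ)
    (hconv : Convex ℝ Ω) (hbdd : Bornology.IsBounded Ω)
    (hg : IsLipschitzMeasurePreservingEmbedding g Ω Ω' L)
    (A₁ A₂ A₃ : Set (EuclideanSpace ℝ (Fin n))) (hA : IsPartition₃ Ω' A₁ A₂ A₃) :
    (volume A₃).toReal ≥
      setDist A₁ A₂ * min (volume A₁).toReal (volume A₂).toReal / (4 * Metric.diam Ω * L) := by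
  -- If the diameter is zero, the right-hand side is a division by zero, hence zero.
  rcases (Metric.diam_nonneg (s := Ω)).eq_or_lt with hD | hD
  · simp [← hD]
  obtain ⟨hfin, hiso⟩ := hg.isoperimetric hconv hbdd hD hA
  have hL := hg.pos
  set d := setDist A₁ A₂
  have hd : 0 ≤ d := setDist_nonneg _ _
  have hmin : 0 ≤ min (volume A₁).toReal (volume A₂).toReal := by positivity
  have hreal : d / L / Metric.diam Ω * min (volume A₁).toReal (volume A₂).toReal ≤
      (volume A₃).toReal := by
    have h := ENNReal.toReal_mono hfin hiso
    rw [ENNReal.toReal_mul, ENNReal.toReal_ofReal (by positivity)] at h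
    refine le_trans ?_ h
    gcongr
    rcases le_total (volume A₁) (volume A₂) with h | h
    · rw [min_eq_left h]; exact min_le_left _ _
    · rw [min_eq_right h]; exact min_le_right _ _
  refine le_trans ?_ hreal
  rw [div_div, div_mul_eq_mul_div]
  apply div_le_div_of_nonneg_left (by positivity) (by positivity)
  -- The factor 4 is pure slack here.
  nlinarith [mul_pos hL hD]
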